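/- All Banach spaces are real. For Banach spaces $X, Y$ let $X\widehat{\otimes}_\pi Y$ denote the projective tensor product, i.e. the completion of $X\otimes Y$ with respect to $\pi(t)=\inf\{\sum_{i}\|x_i\|\|y_i\| : t=\sum_{i} x_i\otimes y_i\}$ (finite sums). Let $L(Y,X^*)$ be the space of bounded operators and $F(Y,X^*)$ its subspace of finite-rank operators; each $T\in L(Y,X^*)$ acts as a bounded functional on $X^{**}\widehat{\otimes}_\pi Y$, determined by $\langle T, x^{**}\otimes y\rangle = x^{**}(Ty)$. A Banach space $E$ has the metric approximation property (MAP) if there is a net $(S_\alpha)$ of finite-rank operators on $E$ with $\|S_\alpha\|\le 1$ and $S_\alpha x\to x$ for all $x\in E$. A subspace $Z$ of a Banach space $W$ is an almost isometric ideal in $W$ if for each $\varepsilon>0$ and each finite-dimensional subspace $E\subseteq W$ there is a linear operator $T:E\to Z$ with $Te=e$ for all $e\in E\cap Z$ and $(1-\varepsilon)\|e\|\le\|Te\|\le(1+\varepsilon)\|e\|$ for all $e\in E$. **Proposition.** Let $X$ and $Y$ be Banach spaces such that $X^{**}$ or $Y$ has the MAP. Then $F(Y,X^*)$ is norming for $X^{**}\widehat{\otimes}_\pi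 Y$, that is, $$\|u\|=\sup\{|\langle T,u\rangle| : T\in F(Y,X^*),\ \|T\|\le 1\}\qquad\text{for every } u\in X^{**}\widehat{\otimes}_\pi Y.$$ Moreover, $X\widehat{\otimes}_\pi Y$ is an almost isometric ideal in $X^{**}\widehat{\otimes}_\pi Y$: the canonical map $X\widehat{\otimes}_\pi Y\to X^{**}\widehat{\otimes}_\pi Y$, determined by $x\otimes y\mapsto J_Xx\otimes y$ with $J_X:X\to X^{**}$ the canonical embedding, is an isometry, and its range is an almost isometric ideal in $X^{**}\widehat{\otimes}_\pi Y$. -/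

import Mathlib

open scoped TensorProduct
open Filter Topology

universe u v w

/-- The algebraic tensor product `X ⊗ Y` of two real normed spaces; a type synonym that carries
the projective (semi)norm. -/
def ProjTensor (X : Type u) (Y : Type v) [NormedAddCommGroup X] [NormedSpace ℝ X]
    [NormedAddCommGroup Y] [NormedSpace ℝ Y] : Type (max u v) :=
  X ⊗[ℝ] Y

namespace ProjTensor

section Norm

set_option linter.unusedSectionVars false

variable {X : Type u} {Y : Type v} [NormedAddCommGroup X] [NormedSpace ℝ X]
  [NormedAddCommGroup Y] [NormedSpace ℝ Y]

noncomputable instance : AddCommGroup (ProjTensor X Y) :=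
  inferInstanceAs (AddCommGroup (X ⊗[ℝ] Y))

noncomputable instance : Module ℝ (ProjTensor X Y) :=
  inferInstanceAs (Module ℝ (X ⊗[ℝ] Y))

/-- The elementary tensor `x ⊗ y`. -/
noncomputable def tmul (x : X) (y : Y) : ProjTensor X Y :=
  TensorProduct.tmul ℝ x y

/-- The tensor `∑ xᵢ ⊗ yᵢ` given by a finite list of pairs `(xᵢ, yᵢ)`. -/
noncomputable def ofList (l : List (X × Y)) : ProjTensor X Y :=
  (l.map fun p => tmul p.1 p.2).sum

/-- The cost `∑ ‖xᵢ‖ ‖yᵢ‖` of a finite list of pairs `(xᵢ, yᵢ)`. -/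
noncomputable def cost (l : List (X × Y)) : ℝ :=
  (l.map fun p => ‖p.1‖ * ‖p.2‖).sum

/-- The projective norm `π(t) = inf {∑ ‖xᵢ‖ ‖yᵢ‖ : t = ∑ xᵢ ⊗ yᵢ}`. -/
noncomputable def projNorm (t : ProjTensor X Y) : ℝ :=
  sInf {r : ℝ | ∃ l : List (X × Y), ofList l = t ∧ cost l = r}

theorem ofList_append (l m : List (X × Y)) : ofList (l ++ m) = ofList l + ofList m := by
  simp [ofList]

theorem cost_append (l m : List (X × Y)) : cost (l ++ m) = cost l + cost m := by
  simp [cost]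

theorem cost_nonneg (l : List (X × Y)) : 0 ≤ cost l := by
  refine List.sum_nonneg ?_
  intro r hr
  obtain ⟨p, -, rfl⟩ := List.mem_map.1 hr
  positivity

theorem exists_ofList (t : ProjTensor X Y) : ∃ l : List (X × Y), ofList l = t := by
  refine TensorProduct.induction_on (motive := fun t => ∃ l : List (X × Y), ofList l = t)
    t ⟨[], rfl⟩ (fun x y => ⟨[(x, y)], ?_⟩) ?_
  · simp only [ofList, List.map_cons, List.map_nil, List.sum_singleton]
    rfl
  · rintro s t ⟨l, rfl⟩ ⟨m, rfl⟩
    exact ⟨l ++ m, ofList_append l m⟩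

theorem ofList_smul (c : ℝ) (l : List (X × Y)) :
    ofList (l.map fun p => (c • p.1, p.2)) = c • ofList l := by
  induction l with
  | nil => exact (smul_zero c).symm
  | cons p l ih =>
    have h : tmul (c • p.1) p.2 = c • tmul p.1 p.2 := TensorProduct.smul_tmul' c p.1 p.2
    simp only [ofList, List.map_cons, List.sum_cons, smul_add, h] at ih ⊢
    rw [ih]

theorem cost_smul (c : ℝ) (l : List (X × Y)) :
    cost (l.map fun p => (c • p.1, p.2)) = |c| * cost l := by
  induction l with
  | nil => simp [cost]
  | cons p l ih =>
    simp only [cost, List.map_cons, List.sum_cons, mul_add, norm_smul, Real.norm_eq_abs] at ih ⊢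
    rw [ih, mul_assoc]

theorem projNorm_le_cost (l : List (X × Y)) : projNorm (ofList l) ≤ cost l :=
  csInf_le ⟨0, by rintro r ⟨m, -, rfl⟩; exact cost_nonneg m⟩ ⟨l, rfl, rfl⟩

theorem le_projNorm {t : ProjTensor X Y} {c : ℝ}
    (h : ∀ l : List (X × Y), ofList l = t → c ≤ cost l) : c ≤ projNorm t := by
  obtain ⟨l, hl⟩ := exists_ofList t
  refine le_csInf ⟨cost l, l, hl, rfl⟩ ?_
  rintro r ⟨m, hm, rfl⟩
  exact h m hm

theorem projNorm_nonneg (t : ProjTensor X Y) : 0 ≤ projNorm t :=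
  le_projNorm fun l _ => cost_nonneg l

theorem projNorm_add_le (s t : ProjTensor X Y) :
    projNorm (s + t) ≤ projNorm s + projNorm t := by
  rw [← sub_le_iff_le_add]
  refine le_projNorm fun l hl => ?_
  rw [sub_le_comm]
  refine le_projNorm fun m hm => ?_
  rw [sub_le_iff_le_add, ← hl, ← hm, add_comm (cost m), ← cost_append, ← ofList_append]
  exact projNorm_le_cost _

theorem projNorm_smul_le (c : ℝ) (t : ProjTensor X Y) :
    projNorm (c • t) ≤ |c| * projNorm t := by
  have key : ∀ l : List (X × Y), ofList l = t → projNorm (c • t) ≤ |c| * cost l := by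
    intro l hl
    rw [← hl, ← ofList_smul, ← cost_smul]
    exact projNorm_le_cost _
  rcases eq_or_ne c 0 with rfl | hc
  · obtain ⟨l, hl⟩ := exists_ofList t
    simpa using key l hl
  · have hc' : 0 < |c| := abs_pos.2 hc
    rw [← div_le_iff₀' hc']
    exact le_projNorm fun l hl => (div_le_iff₀' hc').2 (key l hl)

theorem projNorm_zero : projNorm (0 : ProjTensor X Y) = 0 :=
  le_antisymm (projNorm_le_cost ([] : List (X × Y))) (projNorm_nonneg _)

theorem projNorm_neg (t : ProjTensor X Y) : projNorm (-t) = projNorm t := by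
  have h : ∀ s : ProjTensor X Y, projNorm (-s) ≤ projNorm s := fun s => by
    simpa using projNorm_smul_le (-1) s
  exact le_antisymm (h t) (by simpa using h (-t))

noncomputable instance : SeminormedAddCommGroup (ProjTensor X Y) :=
  AddGroupSeminorm.toSeminormedAddCommGroup
    { toFun := projNorm
      map_zero' := projNorm_zero
      add_le' := projNorm_add_le
      neg' := projNorm_neg }

theorem norm_eq_projNorm (t : ProjTensor X Y) : ‖t‖ = projNorm t := rfl

noncomputable instance : NormedSpace ℝ (ProjTensor X Y) where
  norm_smul_le := projNorm_smul_le

theorem norm_linearMap_le {F : Type*} [SeminormedAddCommGroup F] [NormedSpace ℝ F]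
    (f : ProjTensor X Y →ₗ[ℝ] F) (C : ℝ) (h : ∀ x y, ‖f (tmul x y)‖ ≤ C * (‖x‖ * ‖y‖))
    (hC : 0 ≤ C) (t : ProjTensor X Y) : ‖f t‖ ≤ C * ‖t‖ := by
  have key : ∀ l : List (X × Y), ‖f (ofList l)‖ ≤ C * cost l := by
    intro l
    induction l with
    | nil => simp [ofList, cost]
    | cons p l ih =>
      simp only [ofList, cost, List.map_cons, List.sum_cons, map_add, mul_add] at ih ⊢
      exact (norm_add_le _ _).trans (add_le_add (h _ _) ih)
  rcases hC.eq_or_lt with rfl | hC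
  · obtain ⟨l, rfl⟩ := exists_ofList t
    simpa using key l
  · rw [← div_le_iff₀' hC, norm_eq_projNorm]
    refine le_projNorm fun l hl => (div_le_iff₀' hC).2 ?_
    rw [← hl]
    exact key l

end Norm

/-- The bounded linear map on `X ⊗ Y` induced by a bounded bilinear map. -/
noncomputable def lift {X : Type u} {Y : Type v} {F : Type w}
    [NormedAddCommGroup X] [NormedSpace ℝ X] [NormedAddCommGroup Y] [NormedSpace ℝ Y]
    [SeminormedAddCommGroup F] [NormedSpace ℝ F]
    (B : X →ₗ[ℝ] Y →ₗ[ℝ] F) (C : ℝ) (hC : 0 ≤ C) (hB : ∀ x y, ‖B x y‖ ≤ C * (‖x‖ * ‖y‖)) :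
    ProjTensor X Y →L[ℝ] F :=
  LinearMap.mkContinuous (TensorProduct.lift B : X ⊗[ℝ] Y →ₗ[ℝ] F) C
    (norm_linearMap_le (X := X) (Y := Y) (TensorProduct.lift B : X ⊗[ℝ] Y →ₗ[ℝ] F) C
      (fun x y => by
        have e : (TensorProduct.lift B : X ⊗[ℝ] Y →ₗ[ℝ] F) (x ⊗ₜ[ℝ] y) = B x y :=
          TensorProduct.lift.tmul x y
        exact (congrArg norm e).trans_le (hB x y)) hC)

theorem lift_tmul {X : Type u} {Y : Type v} {F : Type w}
    [NormedAddCommGroup X] [NormedSpace ℝ X] [NormedAddCommGroup Y] [NormedSpace ℝ Y]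
    [SeminormedAddCommGroup F] [NormedSpace ℝ F]
    (B : X →ₗ[ℝ] Y →ₗ[ℝ] F) (C : ℝ) (hC : 0 ≤ C) (hB : ∀ x y, ‖B x y‖ ≤ C * (‖x‖ * ‖y‖))
    (x : X) (y : Y) : lift B C hC hB (tmul x y) = B x y :=
  TensorProduct.lift.tmul x y

/-- The bilinear map `(x, y) ↦ x ⊗ y`. -/
noncomputable def mkBilin (X : Type u) (Y : Type v) [NormedAddCommGroup X] [NormedSpace ℝ X]
    [NormedAddCommGroup Y] [NormedSpace ℝ Y] : X →ₗ[ℝ] Y →ₗ[ℝ] ProjTensor X Y :=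
  TensorProduct.mk ℝ X Y

theorem norm_tmul_le {X : Type u} {Y : Type v} [NormedAddCommGroup X] [NormedSpace ℝ X]
    [NormedAddCommGroup Y] [NormedSpace ℝ Y] (x : X) (y : Y) :
    ‖(tmul x y : ProjTensor X Y)‖ ≤ ‖x‖ * ‖y‖ := by
  rw [norm_eq_projNorm]
  simpa [ofList, cost] using projNorm_le_cost [(x, y)]

end ProjTensor

/-- The projective tensor product `X ⊗̂_π Y`: the completion of the algebraic tensor product with
respect to the projective norm. -/
abbrev ProjTensorProduct (X : Type u) (Y : Type v) [NormedAddCommGroup X] [NormedSpace ℝ X]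
    [NormedAddCommGroup Y] [NormedSpace ℝ Y] : Type (max u v) :=
  UniformSpace.Completion (ProjTensor X Y)

/-- The bidual `X**`. -/
abbrev Bidual (X : Type u) [NormedAddCommGroup X] [NormedSpace ℝ X] : Type u :=
  StrongDual ℝ (StrongDual ℝ X)

section Canonical

variable (X : Type u) (Y : Type v) [NormedAddCommGroup X] [NormedSpace ℝ X]
  [NormedAddCommGroup Y] [NormedSpace ℝ Y]

/-- The canonical map `X ⊗ Y → X** ⊗ Y`, `x ⊗ y ↦ J x ⊗ y`, on the algebraic tensor products,
where `J : X → X**` is the canonical embedding. -/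
noncomputable def algBidualInclusion : ProjTensor X Y →L[ℝ] ProjTensor (Bidual X) Y :=
  ProjTensor.lift
    ((ProjTensor.mkBilin (Bidual X) Y).comp
      (NormedSpace.inclusionInDoubleDual ℝ X).toLinearMap) 1 zero_le_one
    (fun x y => by
      rw [one_mul]
      refine (ProjTensor.norm_tmul_le (NormedSpace.inclusionInDoubleDual ℝ X x) y).trans ?_
      gcongr
      exact NormedSpace.double_dual_bound ℝ X x)

/-- The canonical map `X ⊗̂_π Y → X** ⊗̂_π Y`, the continuous linear extension of
`x ⊗ y ↦ J x ⊗ y`. -/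
noncomputable def bidualInclusion :
    ProjTensorProduct X Y →L[ℝ] ProjTensorProduct (Bidual X) Y :=
  (algBidualInclusion X Y).completion

theorem bidualInclusion_tmul (x : X) (y : Y) :
    bidualInclusion X Y ((ProjTensor.tmul x y : ProjTensor X Y) : ProjTensorProduct X Y) =
      ((ProjTensor.tmul (NormedSpace.inclusionInDoubleDual ℝ X x) y :
        ProjTensor (Bidual X) Y) : ProjTensorProduct (Bidual X) Y) := by
  refine (ContinuousLinearMap.completion_apply_coe (algBidualInclusion X Y) _).trans ?_
  exact congrArg _ (ProjTensor.lift_tmul _ _ _ _ x y)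

variable {X Y}

/-- The functional `x** ⊗ y ↦ x** (T y)` on the algebraic tensor product `X** ⊗ Y` given by
an operator `T : Y → X*`. -/
noncomputable def algTensorPairing (T : Y →L[ℝ] StrongDual ℝ X) :
    ProjTensor (Bidual X) Y →L[ℝ] ℝ :=
  ProjTensor.lift
    (LinearMap.mk₂ ℝ (fun (φ : Bidual X) (y : Y) => φ (T y))
      (fun _ _ _ => rfl) (fun _ _ _ => rfl)
      (fun φ y z => by rw [map_add, map_add]) (fun c φ y => by rw [map_smul, map_smul]))
    ‖T‖ (norm_nonneg T)
    (fun φ y => by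
      calc ‖φ (T y)‖ ≤ ‖φ‖ * ‖T y‖ := φ.le_opNorm _
        _ ≤ ‖φ‖ * (‖T‖ * ‖y‖) := by gcongr; exact T.le_opNorm y
        _ = ‖T‖ * (‖φ‖ * ‖y‖) := by ring)

/-- The bounded functional `u ↦ ⟨T, u⟩` on `X** ⊗̂_π Y` given by an operator `T : Y → X*`; it is
the continuous linear extension of `x** ⊗ y ↦ x** (T y)`. -/
noncomputable def tensorPairing (T : Y →L[ℝ] StrongDual ℝ X) :
    StrongDual ℝ (ProjTensorProduct (Bidual X) Y) :=
  (algTensorPairing T).fromCompletion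

theorem tensorPairing_tmul (T : Y →L[ℝ] StrongDual ℝ X) (φ : Bidual X) (y : Y) :
    tensorPairing T
      ((ProjTensor.tmul φ y : ProjTensor (Bidual X) Y) : ProjTensorProduct (Bidual X) Y) =
      φ (T y) := by
  refine (ContinuousLinearMap.fromCompletion_apply_coe (algTensorPairing T) _).trans ?_
  exact ProjTensor.lift_tmul _ _ _ _ φ y

end Canonical

/-- The set `F(E, F)` of bounded operators of finite rank. -/
def finiteRankOperators (E : Type u) (F : Type v) [NormedAddCommGroup E] [NormedSpace ℝ E]
    [NormedAddCommGroup F] [NormedSpace ℝ F] : Set (E →L[ℝ] F) :=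
  {T | FiniteDimensional ℝ (LinearMap.range T.toLinearMap)}

/-- The metric approximation property: there is a net of finite-rank operators of norm at most
one on `E` which converges pointwise to the identity. -/
def HasMAP (E : Type u) [NormedAddCommGroup E] [NormedSpace ℝ E] : Prop :=
  ∃ (ι : Type u) (_ : Preorder ι) (_ : IsDirectedOrder ι) (_ : Nonempty ι) (S : ι → E →L[ℝ] E),
    (∀ α, S α ∈ finiteRankOperators E E) ∧ (∀ α, ‖S α‖ ≤ 1) ∧
      ∀ x, Tendsto (fun α => S α x) atTop (𝓝 x)

/-- A set `A` of operators `Y → X*` is norming for `X** ⊗̂_π Y` if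
`‖u‖ = sup {|⟨T, u⟩| : T ∈ A, ‖T‖ ≤ 1}` for every `u ∈ X** ⊗̂_π Y`. -/
def IsNormingForTensor {X : Type u} {Y : Type v} [NormedAddCommGroup X] [NormedSpace ℝ X]
    [NormedAddCommGroup Y] [NormedSpace ℝ Y] (A : Set (Y →L[ℝ] StrongDual ℝ X)) : Prop :=
  ∀ u : ProjTensorProduct (Bidual X) Y,
    IsLUB {r : ℝ | ∃ T ∈ A, ‖T‖ ≤ 1 ∧ r = |tensorPairing T u|} ‖u‖

/-- A subspace `Z` of `W` is an almost isometric ideal in `W` if for each `ε > 0` and each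
finite-dimensional subspace `E` of `W` there is a linear `T : E → Z` which fixes the elements of
`E ∩ Z` and satisfies `(1 - ε) ‖e‖ ≤ ‖T e‖ ≤ (1 + ε) ‖e‖` on `E`. -/
def IsAlmostIsometricIdeal {W : Type u} [NormedAddCommGroup W] [NormedSpace ℝ W]
    (Z : Submodule ℝ W) : Prop :=
  ∀ ε : ℝ, 0 < ε → ∀ E : Submodule ℝ W, FiniteDimensional ℝ E →
    ∃ T : E →ₗ[ℝ] Z, (∀ e : E, (e : W) ∈ Z → (T e : W) = e) ∧
      ∀ e : E, (1 - ε) * ‖e‖ ≤ ‖T e‖ ∧ ‖T e‖ ≤ (1 + ε) * ‖e‖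

/-! Write `Z` for the projective tensor product of `X` and `Y`. A bounded functional on `Z` is an
operator `Y → X*`, which also acts on the tensor product `W` of `X**` and `Y`. This gives a
contraction `W → Z**` (`dualPairing`) extending the canonical embedding of `Z`, so the map `Z → W`
is isometric without any approximation property.

Norming: by density, let `u = ∑ φᵢ ⊗ yᵢ`. A Hahn–Banach functional of norm at most one attaining
`‖u‖` is an operator `Y → X***`. The MAP of `X**` or of `Y` replaces its bilinear form by one
passing through a finite-rank operator on `Y`. Since `X*** = (X*)**`, local reflexivity of `X*`
moves this to finite-rank operators `Y → X*` of norm at most `1 + ε`, with arbitrarily small error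
on the finitely many pairs `(yᵢ, φᵢ)`.

Ideal: the norming property makes `W → Z**` isometric. Local reflexivity of `Z`, applied to a
finite-dimensional subspace of `W` viewed in `Z**`, gives the almost isometries into `Z` that fix
the vectors of `Z`.

Local reflexivity is thus used twice, through `exists_linearMap_norm_le` and
`exists_linearMap_almost_isometry`. Both rest on a Hahn–Banach separation for finitely many
conditions, followed by a finite net argument. -/

/-! ### Local reflexivity for finitely many conditions. -/

section LocalReflexivity

/-- If every functional vanishing on `V` is at most its norm at `c`, then the distance of `c` to
`V` is at most one. -/
theorem exists_mem_norm_add_lt {N : Type*} [NormedAddCommGroup N] [NormedSpace ℝ N]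
    (V : Submodule ℝ N) (c : N)
    (h : ∀ f : StrongDual ℝ N, (∀ v ∈ V, f v = 0) → f c ≤ ‖f‖) {r : ℝ} (hr : 1 < r) :
    ∃ v ∈ V, ‖c + v‖ < r := by
  by_contra! hV
  have hr0 : 0 < r := one_pos.trans hr
  obtain ⟨f, s, hs, ht⟩ := geometric_hahn_banach_open (convex_ball (0 : N) r) Metric.isOpen_ball
    (V.convex.translate c) (Set.disjoint_left.2 (by
      rintro _ hx ⟨v, hv, rfl⟩
      exact (hV v hv).not_gt (by simpa using hx)))
  have ht' : ∀ v ∈ V, s ≤ f c + f v := fun v hv => by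
    simpa using ht (c + v) ⟨v, hv, rfl⟩
  -- A functional bounded below on a translate of a subspace vanishes on the subspace: otherwise a
  -- multiple of `v` brings the value down to `s - 1`.
  have hf : ∀ v ∈ V, f v = 0 := by
    intro v hv
    by_contra hne
    have h1 := ht' _ (V.smul_mem ((s - f c - 1) / f v) hv)
    rw [map_smul, smul_eq_mul, div_mul_cancel₀ _ hne] at h1
    linarith
  have hsc : s ≤ f c := by simpa using ht' 0 V.zero_mem
  have hs0 : 0 < s := by simpa using hs 0 (by simpa using hr0)
  have hfpos : 0 < ‖f‖ := (hs0.trans_le hsc).trans_le (h f hf)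
  -- One of `r • x`, `r • -x` lies in the ball of radius `r` and has `f`-value above `‖f‖ ≥ f c ≥
  -- s`, against the separation.
  obtain ⟨x, hx, hfx⟩ := f.exists_lt_apply_of_lt_opNorm
    (show ‖f‖ / r < ‖f‖ from div_lt_self hfpos hr)
  rw [div_lt_iff₀' hr0] at hfx
  have hb : ∀ y : N, ‖y‖ = ‖x‖ → r * f y < s := fun y hy => by
    have := hs (r • y) (by
      rw [mem_ball_zero_iff, norm_smul, hy, Real.norm_of_nonneg hr0.le]
      exact mul_lt_of_lt_one_right hr0 hx)
    simpa using this
  have h1 := hb x rfl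
  have h2 := hb (-x) (norm_neg x)
  rw [map_neg] at h2
  have h3 := h f hf
  rcases abs_cases (f x) with ⟨h4, -⟩ | ⟨h4, -⟩ <;> rw [Real.norm_eq_abs, h4] at hfx <;> linarith

theorem exists_norm_le_one_lt_apply {Z : Type*} [NormedAddCommGroup Z] [NormedSpace ℝ Z]
    (f : StrongDual ℝ Z) {ε : ℝ} (hε : 0 < ε) : ∃ z : Z, ‖z‖ ≤ 1 ∧ ‖f‖ - ε < f z := by
  rcases lt_or_ge (‖f‖ - ε) 0 with h | h
  · exact ⟨0, by simp, by simpa using h⟩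
  · obtain ⟨x, hx, hfx⟩ := f.exists_lt_apply_of_lt_opNorm (sub_lt_self ‖f‖ hε)
    rcases abs_cases (f x) with ⟨h4, -⟩ | ⟨h4, -⟩ <;> rw [Real.norm_eq_abs, h4] at hfx
    · exact ⟨x, hx.le, hfx⟩
    · exact ⟨-x, by simpa using hx.le, by simpa using hfx⟩

/-- The dual of a finite sup-norm power is an `ℓ¹`-sum: a vector whose coordinates nearly norm the
components of `f` lies in the unit ball, and `f` nearly takes the sum of their norms there. -/
theorem sum_norm_comp_single_le {Z : Type*} [NormedAddCommGroup Z] [NormedSpace ℝ Z]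
    {κ : Type*} [Fintype κ] [DecidableEq κ] (f : StrongDual ℝ (κ → Z)) :
    ∑ k, ‖f.comp (ContinuousLinearMap.single ℝ (fun _ : κ => Z) k)‖ ≤ ‖f‖ := by
  refine le_of_forall_pos_le_add fun ε hε => ?_
  have hδ : 0 < ε / (Fintype.card κ + 1) := by positivity
  choose z hz hfz using fun k => exists_norm_le_one_lt_apply
    (f.comp (ContinuousLinearMap.single ℝ (fun _ : κ => Z) k)) hδ
  have h1 : ∀ k, ‖f.comp (ContinuousLinearMap.single ℝ (fun _ : κ => Z) k)‖ ≤
      f (Pi.single k (z k)) + ε / (Fintype.card κ + 1) := fun k => by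
    have h4 := hfz k
    simp only [ContinuousLinearMap.comp_apply, ContinuousLinearMap.single_apply] at h4
    linarith
  refine (Finset.sum_le_sum fun k _ => h1 k).trans ?_
  rw [Finset.sum_add_distrib, ← map_sum, Finset.univ_sum_single]
  refine add_le_add ?_ ?_
  · refine (le_abs_self _).trans ((f.le_opNorm z).trans ?_)
    exact mul_le_of_le_one_right (norm_nonneg f) ((pi_norm_le_iff_of_nonneg zero_le_one).2 hz)
  · rw [Finset.sum_const, nsmul_eq_mul, Finset.card_univ, mul_div_assoc', div_le_iff₀ (by positivity)]
    nlinarith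

/-- A linear map on a finite-dimensional space which vanishes on `E₀` is a finite sum of rank-one
maps vanishing on `E₀`. -/
theorem exists_eq_sum_smul_of_vanish {E F : Type*} [AddCommGroup E] [Module ℝ E]
    [FiniteDimensional ℝ E] [AddCommGroup F] [Module ℝ F] (E₀ : Submodule ℝ E)
    (ζ : E →ₗ[ℝ] F) (hζ : ∀ e ∈ E₀, ζ e = 0) :
    ∃ (n : ℕ) (c : Fin n → E →ₗ[ℝ] ℝ) (y : Fin n → F), (∀ l, ∀ e ∈ E₀, c l e = 0) ∧
      ∀ e, ζ e = ∑ l, c l e • y l := by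
  let b := Module.finBasis ℝ (E ⧸ E₀)
  refine ⟨_, fun l => (b.coord l).comp E₀.mkQ, fun l => E₀.liftQ ζ hζ (b l), fun l e he => ?_,
    fun e => ?_⟩
  · simp [(Submodule.Quotient.mk_eq_zero E₀).2 he]
  · have h1 : ζ e = E₀.liftQ ζ hζ (E₀.mkQ e) := (E₀.liftQ_apply ζ e).symm
    rw [h1]
    conv_lhs => rw [← b.sum_repr (E₀.mkQ e)]
    rw [map_sum]
    exact Finset.sum_congr rfl fun l _ => map_smul _ _ _

variable {Z : Type*} [NormedAddCommGroup Z] [NormedSpace ℝ Z] {E : Type*}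
  [NormedAddCommGroup E] [NormedSpace ℝ E] [FiniteDimensional ℝ E]

/-- Local reflexivity for finitely many norm conditions and finitely many functionals. -/
theorem exists_linearMap_of_finite_conditions (j : E →ₗ[ℝ] StrongDual ℝ Z →ₗ[ℝ] ℝ) (E₀ : Submodule ℝ E)
    (R₀ : E →ₗ[ℝ] Z)
    (hR₀ : ∀ e ∈ E₀, ∀ φ : StrongDual ℝ Z, φ (R₀ e) = j e φ)
    {κ μ : Type*} [Fintype κ] [Fintype μ] (a : κ → E) (ha : ∀ k φ, j (a k) φ ≤ ‖φ‖)
    (b : μ → E) (φ : μ → StrongDual ℝ Z) {ε : ℝ} (hε : 0 < ε) :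
    ∃ R : E →ₗ[ℝ] Z, (∀ e ∈ E₀, R e = R₀ e) ∧ (∀ k, ‖R (a k)‖ < 1 + ε) ∧
      ∀ m, |φ m (R (b m)) - j (b m) (φ m)| < ε := by
  classical
  obtain ⟨δ, hδ, hδε⟩ : ∃ δ : ℝ, 0 < δ ∧ δ * (1 + ε) ≤ ε :=
    ⟨ε / (1 + ε), by positivity, (div_mul_cancel₀ _ (by positivity)).le⟩
  -- In the sup norm, the weight `δ⁻¹` turns the single bound `1 + ε` into an error below `δ * (1 +
  -- ε) ≤ ε` in the scalar coordinates.
  let A : (E →ₗ[ℝ] Z) →ₗ[ℝ] (κ → Z) × (μ → ℝ) :=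
    { toFun := fun S => (fun k => S (a k), fun m => δ⁻¹ * φ m (S (b m)))
      map_add' := fun S T => by ext <;> simp [mul_add]
      map_smul' := fun c S => by ext <;> simp [mul_left_comm] }
  let V : Submodule ℝ (E →ₗ[ℝ] Z) :=
    { carrier := {S | ∀ e ∈ E₀, S e = 0}
      add_mem' := fun {S T} hS hT e he => by simp [hS e he, hT e he]
      zero_mem' := fun e _ => rfl
      smul_mem' := fun c S hS e he => by simp [hS e he] }
  -- Corrections of `R₀` range over `V`, so the claim is that `c + A S` has norm below `1 + ε` for
  -- some `S ∈ V`.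
  let c : (κ → Z) × (μ → ℝ) := A R₀ - (0, fun m => δ⁻¹ * j (b m) (φ m))
  have hcA : ∀ f : StrongDual ℝ ((κ → Z) × (μ → ℝ)), ∀ (w : κ → Z) (t : μ → ℝ), f (w, t) =
      ∑ k, f (Pi.single k (w k), 0) + ∑ m, f (0, Pi.single m 1) * t m := by
    intro f w t
    have h1 : (w, t) = ContinuousLinearMap.inl ℝ (κ → Z) (μ → ℝ) (∑ k, Pi.single k (w k)) +
        ContinuousLinearMap.inr ℝ (κ → Z) (μ → ℝ) (∑ m, t m • Pi.single m 1) := by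
      rw [Finset.univ_sum_single]
      have : ∑ m, t m • (Pi.single m 1 : μ → ℝ) = t := (pi_eq_sum_univ' t).symm
      rw [this]; simp
    rw [h1, map_add, map_sum, map_sum, map_sum, map_sum]
    simp only [map_smul, smul_eq_mul, ContinuousLinearMap.inl_apply,
      ContinuousLinearMap.inr_apply, mul_comm]
  obtain ⟨v, hv, hcv⟩ := exists_mem_norm_add_lt (V.map A) c (fun f hf => by
    let ψ : κ → StrongDual ℝ Z := fun k =>
      (f.comp (ContinuousLinearMap.inl ℝ (κ → Z) (μ → ℝ))).comp
        (ContinuousLinearMap.single ℝ (fun _ : κ => Z) k)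
    let β : μ → ℝ := fun m => f (0, Pi.single m 1) * δ⁻¹
    have hfA : ∀ S : E →ₗ[ℝ] Z,
        f (A S) = ∑ k, ψ k (S (a k)) + ∑ m, β m * φ m (S (b m)) := fun S => by
      refine (hcA f _ _).trans ?_
      simp [ψ, β, mul_assoc]
    let J : E →ₗ[ℝ] StrongDual ℝ Z →ₗ[ℝ] ℝ := LinearMap.mk₂ ℝ (fun e χ => χ (R₀ e))
      (by simp) (by simp) (by simp) (by simp)
    obtain ⟨n, p, y, hp, hsum⟩ := exists_eq_sum_smul_of_vanish E₀ (j - J)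
      (fun e he => by ext χ; simp [J, hR₀ e he])
    -- Testing `f` on the rank-one maps `p l ⊗ z` of `V` gives a relation in `Z*`. Applying `y l` to
    -- it needs only linearity, and summing over `l` shows that `f` also annihilates the
    -- bidual-valued map `j - J`.
    have hz : ∀ l, ∑ k, p l (a k) • ψ k + ∑ m, (β m * p l (b m)) • φ m = 0 := by
      intro l
      ext z
      have h1 := hf (A ((p l).smulRight z)) ⟨_, fun e he => by simp [hp l e he], rfl⟩
      rw [hfA] at h1
      simpa [mul_assoc] using h1
    have h2 : ∑ k, j (a k) (ψ k) - ∑ k, ψ k (R₀ (a k)) +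
        (∑ m, β m * j (b m) (φ m) - ∑ m, β m * φ m (R₀ (b m))) = 0 := by
      have h3 : ∀ (e : E) (χ : StrongDual ℝ Z), j e χ - χ (R₀ e) = ∑ l, p l e * y l χ := by
        intro e χ
        have := LinearMap.congr_fun (hsum e) χ
        simpa [J] using this
      rw [← Finset.sum_sub_distrib, ← Finset.sum_sub_distrib]
      simp_rw [← mul_sub, h3, Finset.mul_sum]
      rw [Finset.sum_comm, Finset.sum_comm (s := (Finset.univ : Finset μ)),
        ← Finset.sum_add_distrib]
      refine Finset.sum_eq_zero fun l _ => ?_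
      have := congrArg (y l) (hz l)
      simpa [mul_assoc] using this
    have h4 : f c = ∑ k, j (a k) (ψ k) := by
      have h5 : f (0, fun m => δ⁻¹ * j (b m) (φ m)) = ∑ m, β m * j (b m) (φ m) := by
        have h0 : f (0, 0) = 0 := map_zero f
        rw [show (0 : κ → Z) = fun _ => 0 from rfl, hcA]
        simp [β, mul_assoc, h0]
      have h6 : f c = f (A R₀) - f (0, fun m => δ⁻¹ * j (b m) (φ m)) := map_sub f _ _
      rw [h6, h5, hfA]
      linarith
    rw [h4]
    refine (Finset.sum_le_sum fun k _ => ha k (ψ k)).trans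
      ((sum_norm_comp_single_le _).trans ?_)
    refine (f.opNorm_comp_le _).trans (mul_le_of_le_one_right (norm_nonneg f) ?_)
    exact ContinuousLinearMap.opNorm_le_bound _ zero_le_one fun x => by simp)
    (lt_add_of_pos_right 1 hε)
  obtain ⟨S, hS, rfl⟩ := hv
  obtain ⟨h1, h2⟩ := (max_lt_iff.1 (show max _ _ < _ from hcv))
  refine ⟨R₀ + S, fun e he => by simp [hS e he], fun k => ?_, fun m => ?_⟩
  · simpa [c, A] using (norm_le_pi_norm _ k).trans_lt h1
  · have h3 := (norm_le_pi_norm _ m).trans_lt h2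
    have h4 : (c + A S).2 m = δ⁻¹ * (φ m ((R₀ + S) (b m)) - j (b m) (φ m)) := by
      simp [c, A]; ring
    rw [h4, norm_mul, Real.norm_of_nonneg (by positivity), inv_mul_lt_iff₀ hδ] at h3
    exact h3.trans_le hδε

end LocalReflexivity

/-! ### From finite nets to norm bounds on the whole space. -/

section LocalReflexivityBounds

variable {Z : Type*} [NormedAddCommGroup Z] [NormedSpace ℝ Z] {E : Type*}
  [NormedAddCommGroup E] [NormedSpace ℝ E] [FiniteDimensional ℝ E]

theorem exists_finite_net_closedBall (E : Type*) [NormedAddCommGroup E] [NormedSpace ℝ E]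
    [FiniteDimensional ℝ E] {η : ℝ} (hη : 0 < η) :
    ∃ t : Finset E, (∀ a ∈ t, ‖a‖ ≤ 1) ∧ ∀ e : E, ‖e‖ ≤ 1 → ∃ a ∈ t, ‖e - a‖ < η := by
  have := FiniteDimensional.proper_real E
  obtain ⟨t, ht, htf, hcov⟩ := (isCompact_closedBall (0 : E) 1).finite_cover_balls hη
  refine ⟨htf.toFinset, fun a ha => by simpa using ht (htf.mem_toFinset.1 ha), fun e he => ?_⟩
  obtain ⟨a, ha, hea⟩ := Set.mem_iUnion₂.1 (hcov (by simpa using he : e ∈ Metric.closedBall 0 1))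
  exact ⟨a, htf.mem_toFinset.2 ha, by simpa [dist_eq_norm] using hea⟩

/-- Local reflexivity: a contraction `j : E → Z**` on a finite-dimensional space is approximated on
finitely many pairs by an operator `E → Z` of norm at most `1 + ε`, with prescribed values on the
part of `E` which `j` maps into `Z`. -/
theorem exists_linearMap_norm_le (j : E →ₗ[ℝ] StrongDual ℝ Z →ₗ[ℝ] ℝ)
    (hj : ∀ e φ, |j e φ| ≤ ‖e‖ * ‖φ‖) (E₀ : Submodule ℝ E) (R₀ : E →ₗ[ℝ] Z)
    (hR₀ : ∀ e ∈ E₀, ∀ φ : StrongDual ℝ Z, φ (R₀ e) = j e φ)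
    {μ : Type*} [Fintype μ] (b : μ → E) (φ : μ → StrongDual ℝ Z) {ε : ℝ} (hε : 0 < ε) :
    ∃ R : E →ₗ[ℝ] Z, (∀ e ∈ E₀, R e = R₀ e) ∧ (∀ e, ‖R e‖ ≤ (1 + ε) * ‖e‖) ∧
      ∀ m, |φ m (R (b m)) - j (b m) (φ m)| < ε := by
  have hη : 0 < ε / (2 * (1 + ε)) := by positivity
  obtain ⟨t, ht, hnet⟩ := exists_finite_net_closedBall E hη
  obtain ⟨R, hR, hRt, hRφ⟩ := exists_linearMap_of_finite_conditions j E₀ R₀ hR₀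
    (fun k : t => (k : E)) (fun k χ => (le_abs_self _).trans ((hj _ χ).trans
      (mul_le_of_le_one_left (norm_nonneg χ) (ht k k.2)))) b φ (half_pos hε)
  refine ⟨R, hR, ?_, fun m => (hRφ m).trans (half_lt_self hε)⟩
  let R' : E →L[ℝ] Z := LinearMap.toContinuousLinearMap R
  -- The net controls `R'` up to a multiple of its own norm, which is then absorbed; the mesh is
  -- chosen so that this yields exactly `1 + ε`.
  have h1 : ‖R'‖ ≤ 1 + ε / 2 + ‖R'‖ * (ε / (2 * (1 + ε))) := by
    refine ContinuousLinearMap.opNorm_le_of_unit_norm (by positivity) fun e he => ?_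
    obtain ⟨a, ha, hea⟩ := hnet e he.le
    have h2 : R' e = R a + R' (e - a) := by simp [R']
    rw [h2]
    refine (norm_add_le _ _).trans (add_le_add (hRt ⟨a, ha⟩).le ((R'.le_opNorm _).trans ?_))
    gcongr
  have h3 : ‖R'‖ ≤ 1 + ε := by
    have h4 : (1 + ε) * (ε / (2 * (1 + ε))) = ε / 2 := by field_simp
    have h5 : ε / (2 * (1 + ε)) < 1 := by
      rw [div_lt_one (by positivity)]; linarith
    by_contra! h6
    nlinarith [mul_pos (sub_pos.2 h6) (sub_pos.2 h5)]
  exact fun e => R'.le_of_opNorm_le h3 e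

/-- Local reflexivity for an isometry `j : E → Z**`: the operator `E → Z` can be chosen to be an
almost isometry. -/
theorem exists_linearMap_almost_isometry (j : E →ₗ[ℝ] StrongDual ℝ Z →ₗ[ℝ] ℝ)
    (hj : ∀ e φ, |j e φ| ≤ ‖e‖ * ‖φ‖)
    (hj' : ∀ e, ∀ r < ‖e‖, ∃ φ : StrongDual ℝ Z, ‖φ‖ ≤ 1 ∧ r < |j e φ|)
    (E₀ : Submodule ℝ E) (R₀ : E →ₗ[ℝ] Z)
    (hR₀ : ∀ e ∈ E₀, ∀ φ : StrongDual ℝ Z, φ (R₀ e) = j e φ) {ε : ℝ} (hε : 0 < ε) :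
    ∃ R : E →ₗ[ℝ] Z, (∀ e ∈ E₀, R e = R₀ e) ∧
      ∀ e, (1 - ε) * ‖e‖ ≤ ‖R e‖ ∧ ‖R e‖ ≤ (1 + ε) * ‖e‖ := by
  obtain ⟨δ, hδ, hδ1, hδε⟩ : ∃ δ : ℝ, 0 < δ ∧ δ ≤ 1 ∧ 5 * δ ≤ ε :=
    ⟨min 1 (ε / 5), by positivity, min_le_left _ _, by linarith [min_le_right 1 (ε / 5)]⟩
  obtain ⟨t, ht, hnet⟩ := exists_finite_net_closedBall E hδ
  -- Lower bounds come from functionals nearly norming `j` at the net points. For a unit vector the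
  -- total loss is at most `4 * δ + δ ^ 2 ≤ 5 * δ`.
  choose φ hφ hφj using fun k : t => hj' k (‖(k : E)‖ - δ) (sub_lt_self _ hδ)
  obtain ⟨R, hR, hRn, hRφ⟩ := exists_linearMap_norm_le j hj E₀ R₀ hR₀
    (fun k : t => (k : E)) φ hδ
  refine ⟨R, hR, fun e => ⟨?_, (hRn e).trans (by gcongr; linarith)⟩⟩
  have key : ∀ e : E, ‖e‖ = 1 → 1 - ε ≤ ‖R e‖ := by
    intro e he
    obtain ⟨a, ha, hea⟩ := hnet e he.le
    have h1 := abs_sub_abs_le_abs_sub (j a (φ ⟨a, ha⟩)) (φ ⟨a, ha⟩ (R a))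
    rw [abs_sub_comm] at h1
    have h2 := hRφ ⟨a, ha⟩
    have h3 := hφj ⟨a, ha⟩
    have h4 : |φ ⟨a, ha⟩ (R a)| ≤ ‖R a‖ := by
      simpa using (φ ⟨a, ha⟩).le_of_opNorm_le (hφ ⟨a, ha⟩) (R a)
    have h5 := norm_sub_norm_le e a
    have h6 : ‖R a‖ - ‖R e‖ ≤ (1 + δ) * δ := by
      refine (norm_sub_norm_le _ _).trans ?_
      rw [← map_sub, ← norm_neg, ← map_neg, neg_sub]
      exact (hRn _).trans (by gcongr)
    dsimp only at h2 h3
    nlinarith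
  rcases eq_or_ne e 0 with rfl | he
  · simp
  · have h0 : 0 < ‖e‖ := norm_pos_iff.2 he
    have h1 := key (‖e‖⁻¹ • e) (by rw [norm_smul, norm_inv, norm_norm, inv_mul_cancel₀ h0.ne'])
    rw [map_smul, norm_smul, norm_inv, norm_norm, le_inv_mul_iff₀ h0] at h1
    linarith

end LocalReflexivityBounds

/-! ### Duality between projective tensor products and operators. -/

section TensorDuality

variable {X : Type u} {Y : Type v} [NormedAddCommGroup X] [NormedSpace ℝ X]
  [NormedAddCommGroup Y] [NormedSpace ℝ Y]

namespace ProjTensor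

theorem tmul_add_left (x x' : X) (y : Y) : tmul (x + x') y = tmul x y + tmul x' y :=
  TensorProduct.add_tmul x x' y

theorem tmul_add_right (x : X) (y y' : Y) : tmul x (y + y') = tmul x y + tmul x y' :=
  TensorProduct.tmul_add x y y'

theorem tmul_smul_left (c : ℝ) (x : X) (y : Y) : tmul (c • x) y = c • tmul x y :=
  TensorProduct.smul_tmul' c x y

theorem tmul_smul_right (c : ℝ) (x : X) (y : Y) : tmul x (c • y) = c • tmul x y :=
  TensorProduct.tmul_smul c x y

theorem map_ofList {F : Type*} [AddCommGroup F] [Module ℝ F] (f : ProjTensor X Y →ₗ[ℝ] F)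
    (l : List (X × Y)) : f (ofList l) = (l.map fun p => f (tmul p.1 p.2)).sum := by
  rw [ofList, map_list_sum, List.map_map]
  rfl

theorem norm_lift_le {F : Type w} [SeminormedAddCommGroup F] [NormedSpace ℝ F]
    (B : X →ₗ[ℝ] Y →ₗ[ℝ] F) (C : ℝ) (hC : 0 ≤ C) (hB : ∀ x y, ‖B x y‖ ≤ C * (‖x‖ * ‖y‖)) :
    ‖lift B C hC hB‖ ≤ C :=
  ContinuousLinearMap.opNorm_le_bound _ hC fun t =>
    norm_linearMap_le (lift B C hC hB).toLinearMap C
      (fun x y => (congrArg norm (lift_tmul B C hC hB x y)).trans_le (hB x y)) hC t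

end ProjTensor

/-- Bounded operators on the projective tensor product which agree on elementary tensors are
equal. -/
theorem ProjTensorProduct.ext_tmul {F : Type*} [NormedAddCommGroup F] [NormedSpace ℝ F]
    {f g : ProjTensorProduct X Y →L[ℝ] F}
    (h : ∀ (x : X) (y : Y), f ((ProjTensor.tmul x y : ProjTensor X Y) : ProjTensorProduct X Y) =
      g ((ProjTensor.tmul x y : ProjTensor X Y) : ProjTensorProduct X Y)) : f = g := by
  ext u
  induction u using UniformSpace.Completion.induction_on with
  | hp => exact isClosed_eq f.continuous g.continuous
  | ih t =>
    obtain ⟨l, rfl⟩ := ProjTensor.exists_ofList t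
    have hf := ProjTensor.map_ofList
      (f.comp (UniformSpace.Completion.toComplL (𝕜 := ℝ) (E := ProjTensor X Y))).toLinearMap l
    have hg := ProjTensor.map_ofList
      (g.comp (UniformSpace.Completion.toComplL (𝕜 := ℝ) (E := ProjTensor X Y))).toLinearMap l
    refine hf.trans (Eq.trans ?_ hg.symm)
    exact congrArg List.sum (List.map_congr_left fun p _ => h p.1 p.2)

/-- The operator `Y → X*` with `(T y) x = h (x ⊗ y)` given by a bounded functional `h` on
`X ⊗̂_π Y`. -/
noncomputable def toOperator (h : StrongDual ℝ (ProjTensorProduct X Y)) :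
    Y →L[ℝ] StrongDual ℝ X :=
  LinearMap.mkContinuous₂
    (LinearMap.mk₂ ℝ
      (fun (y : Y) (x : X) => h ((ProjTensor.tmul x y : ProjTensor X Y) : ProjTensorProduct X Y))
      (fun y y' x => by
        rw [ProjTensor.tmul_add_right, UniformSpace.Completion.coe_add, map_add])
      (fun c y x => by
        rw [ProjTensor.tmul_smul_right, UniformSpace.Completion.coe_smul, map_smul])
      (fun y x x' => by
        rw [ProjTensor.tmul_add_left, UniformSpace.Completion.coe_add, map_add])
      (fun c y x => by
        rw [ProjTensor.tmul_smul_left, UniformSpace.Completion.coe_smul, map_smul]))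
    ‖h‖ (fun y x => by
      refine (h.le_opNorm _).trans ?_
      rw [UniformSpace.Completion.norm_coe, mul_assoc]
      gcongr
      rw [mul_comm]
      exact ProjTensor.norm_tmul_le x y)

theorem toOperator_apply (h : StrongDual ℝ (ProjTensorProduct X Y)) (y : Y) (x : X) :
    toOperator h y x = h ((ProjTensor.tmul x y : ProjTensor X Y) : ProjTensorProduct X Y) :=
  rfl

theorem norm_toOperator_le (h : StrongDual ℝ (ProjTensorProduct X Y)) : ‖toOperator h‖ ≤ ‖h‖ :=
  LinearMap.mkContinuous₂_norm_le _ (norm_nonneg h) _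

theorem norm_tensorPairing_le (T : Y →L[ℝ] StrongDual ℝ X) : ‖tensorPairing T‖ ≤ ‖T‖ := by
  refine ContinuousLinearMap.opNorm_le_bound _ (norm_nonneg T) fun u => ?_
  induction u using UniformSpace.Completion.induction_on with
  | hp => exact isClosed_le (by fun_prop) (by fun_prop)
  | ih t =>
    rw [tensorPairing, ContinuousLinearMap.fromCompletion_apply_coe,
      UniformSpace.Completion.norm_coe]
    exact (algTensorPairing T).le_of_opNorm_le (ProjTensor.norm_lift_le _ _ _ _) t

theorem tensorPairing_ofList (T : Y →L[ℝ] StrongDual ℝ X) (l : List (Bidual X × Y)) :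
    tensorPairing T ((ProjTensor.ofList l : ProjTensor (Bidual X) Y) :
      ProjTensorProduct (Bidual X) Y) = (l.map fun p => p.1 (T p.2)).sum := by
  refine (ProjTensor.map_ofList ((tensorPairing T).comp
    (UniformSpace.Completion.toComplL (𝕜 := ℝ) (E := ProjTensor (Bidual X) Y))).toLinearMap
      l).trans ?_
  exact congrArg List.sum (List.map_congr_left fun p _ => tensorPairing_tmul T p.1 p.2)

theorem tensorPairing_add (S T : Y →L[ℝ] StrongDual ℝ X) :
    tensorPairing (S + T) = tensorPairing S + tensorPairing T :=
  ProjTensorProduct.ext_tmul fun φ y => by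
    simp only [add_apply, tensorPairing_tmul, map_add]

theorem tensorPairing_smul (c : ℝ) (T : Y →L[ℝ] StrongDual ℝ X) :
    tensorPairing (c • T) = c • tensorPairing T :=
  ProjTensorProduct.ext_tmul fun φ y => by
    simp only [smul_apply, tensorPairing_tmul, map_smul]

theorem norm_bidualInclusion_le (z : ProjTensorProduct X Y) : ‖bidualInclusion X Y z‖ ≤ ‖z‖ := by
  induction z using UniformSpace.Completion.induction_on with
  | hp => exact isClosed_le (by fun_prop) (by fun_prop)
  | ih t =>
    rw [bidualInclusion, ContinuousLinearMap.completion_apply_coe,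
      UniformSpace.Completion.norm_coe, UniformSpace.Completion.norm_coe]
    simpa using (algBidualInclusion X Y).le_of_opNorm_le (ProjTensor.norm_lift_le _ _ _ _) t

/-- The pairing of `X** ⊗̂_π Y` with the dual of `X ⊗̂_π Y`, which extends the evaluation on
`X ⊗̂_π Y`. -/
noncomputable def dualPairing (X : Type u) (Y : Type v) [NormedAddCommGroup X] [NormedSpace ℝ X]
    [NormedAddCommGroup Y] [NormedSpace ℝ Y] :
    ProjTensorProduct (Bidual X) Y →ₗ[ℝ] StrongDual ℝ (ProjTensorProduct X Y) →ₗ[ℝ] ℝ :=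
  LinearMap.mk₂ ℝ (fun u h => tensorPairing (toOperator h) u)
    (fun u u' h => map_add _ u u') (fun c u h => map_smul _ c u)
    (fun u h h' => by
      have e : toOperator (h + h') = toOperator h + toOperator h' := rfl
      rw [e, tensorPairing_add]; rfl)
    (fun c u h => by
      have e : toOperator (c • h) = c • toOperator h := rfl
      rw [e, tensorPairing_smul]; rfl)

theorem dualPairing_apply (u : ProjTensorProduct (Bidual X) Y)
    (h : StrongDual ℝ (ProjTensorProduct X Y)) :
    dualPairing X Y u h = tensorPairing (toOperator h) u :=
  rfl

theorem abs_dualPairing_le (u : ProjTensorProduct (Bidual X) Y)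
    (h : StrongDual ℝ (ProjTensorProduct X Y)) : |dualPairing X Y u h| ≤ ‖u‖ * ‖h‖ := by
  rw [mul_comm]
  exact (tensorPairing (toOperator h)).le_of_opNorm_le
    ((norm_tensorPairing_le _).trans (norm_toOperator_le h)) u

theorem dualPairing_bidualInclusion (z : ProjTensorProduct X Y)
    (h : StrongDual ℝ (ProjTensorProduct X Y)) :
    dualPairing X Y (bidualInclusion X Y z) h = h z := by
  have e : (tensorPairing (toOperator h)).comp (bidualInclusion X Y) = h :=
    ProjTensorProduct.ext_tmul fun x y => by
      rw [ContinuousLinearMap.comp_apply, bidualInclusion_tmul, tensorPairing_tmul]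
      rfl
  exact congrArg (fun f : StrongDual ℝ (ProjTensorProduct X Y) => f z) e

/-- The canonical map `X ⊗̂_π Y → X** ⊗̂_π Y` is an isometry. -/
theorem isometry_bidualInclusion (X : Type u) (Y : Type v) [NormedAddCommGroup X]
    [NormedSpace ℝ X] [NormedAddCommGroup Y] [NormedSpace ℝ Y] :
    Isometry (bidualInclusion X Y) := by
  refine AddMonoidHomClass.isometry_of_norm _ fun z => (norm_bidualInclusion_le z).antisymm ?_
  obtain ⟨h, hh, hz⟩ := exists_dual_vector'' ℝ z
  have h1 := abs_dualPairing_le (bidualInclusion X Y z) h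
  rw [dualPairing_bidualInclusion, hz] at h1
  refine (le_abs_self _).trans (h1.trans ?_)
  exact mul_le_of_le_one_right (norm_nonneg _) hh

end TensorDuality

/-! ### Finite-rank operators are norming. -/

section Norming

/-- A finite-rank operator into a space which acts on `Z*` is approximated, on finitely many pairs,
by finite-rank operators into `Z`. -/
theorem exists_finiteRank_approx {D Y Z : Type*} [NormedAddCommGroup D] [NormedSpace ℝ D]
    [NormedAddCommGroup Y] [NormedSpace ℝ Y] [NormedAddCommGroup Z] [NormedSpace ℝ Z]
    (T : Y →L[ℝ] D) (hT : T ∈ finiteRankOperators Y D) (q : D →ₗ[ℝ] StrongDual ℝ Z →ₗ[ℝ] ℝ)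
    (hq : ∀ d φ, |q d φ| ≤ ‖d‖ * ‖φ‖) {μ : Type*} [Fintype μ] (y : μ → Y)
    (φ : μ → StrongDual ℝ Z) {ε : ℝ} (hε : 0 < ε) :
    ∃ S ∈ finiteRankOperators Y Z, ‖S‖ ≤ (1 + ε) * ‖T‖ ∧
      ∀ m, |φ m (S (y m)) - q (T (y m)) (φ m)| < ε := by
  have : FiniteDimensional ℝ (LinearMap.range T.toLinearMap) := hT
  let T' : Y →L[ℝ] LinearMap.range T.toLinearMap := T.codRestrict _ fun y => ⟨y, rfl⟩
  obtain ⟨R, -, hR, hRφ⟩ := exists_linearMap_norm_le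
    (q.comp (LinearMap.range T.toLinearMap).subtype) (fun e χ => hq e χ) ⊥ 0
    (fun e he χ => by simp [(Submodule.mem_bot ℝ).1 he]) (fun m => T' (y m)) φ hε
  refine ⟨(LinearMap.toContinuousLinearMap R).comp T', ?_, ?_, hRφ⟩
  · exact Submodule.finiteDimensional_of_le (LinearMap.range_comp_le_range T'.toLinearMap R)
  · refine ContinuousLinearMap.opNorm_le_bound _ (by positivity) fun z => (hR (T' z)).trans ?_
    rw [mul_assoc]
    gcongr
    exact T.le_opNorm z

theorem continuous_toOperator_apply {V : Type u} {Y : Type v} [NormedAddCommGroup V]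
    [NormedSpace ℝ V] [NormedAddCommGroup Y] [NormedSpace ℝ Y]
    (h : StrongDual ℝ (ProjTensorProduct V Y)) (x : V) :
    Continuous fun y => toOperator h y x := by
  fun_prop

/-- The bilinear form `(y, x) ↦ h (x ⊗ y)` given by a bounded functional `h` on `V ⊗̂_π Y`. -/
noncomputable def toBilin {V : Type u} {Y : Type v} [NormedAddCommGroup V]
    [NormedSpace ℝ V] [NormedAddCommGroup Y] [NormedSpace ℝ Y]
    (h : StrongDual ℝ (ProjTensorProduct V Y)) : Y →ₗ[ℝ] V →ₗ[ℝ] ℝ :=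
  LinearMap.mk₂ ℝ (fun y x => toOperator h y x)
    (fun y y' x => by rw [map_add]; rfl) (fun c y x => by rw [map_smul]; rfl)
    (fun y x x' => map_add _ _ _) (fun c y x => map_smul _ _ _)

/-- The bilinear form induced by a functional on `V ⊗̂_π Y` and a finite-rank contraction of `V`
factors through a finite-dimensional space. -/
theorem exists_finiteDimensional_factorization {V : Type u} {Y : Type v} [NormedAddCommGroup V]
    [NormedSpace ℝ V] [NormedAddCommGroup Y] [NormedSpace ℝ Y]
    (h : StrongDual ℝ (ProjTensorProduct V Y)) (S : V →L[ℝ] V) (hS : S ∈ finiteRankOperators V V)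
    (hS1 : ‖S‖ ≤ 1) :
    ∃ (D : Type u) (_ : NormedAddCommGroup D) (_ : NormedSpace ℝ D) (_ : FiniteDimensional ℝ D)
      (T : Y →L[ℝ] D) (q : D →ₗ[ℝ] V →ₗ[ℝ] ℝ), ‖T‖ ≤ ‖h‖ ∧ (∀ d x, |q d x| ≤ ‖d‖ * ‖x‖) ∧
        ∀ y x, q (T y) x = toOperator h y (S x) := by
  let G : Submodule ℝ V := LinearMap.range S.toLinearMap
  have : FiniteDimensional ℝ G := hS
  let S' : V →L[ℝ] G := S.codRestrict _ fun y => ⟨y, rfl⟩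
  have : FiniteDimensional ℝ (StrongDual ℝ G) := inferInstance
  refine ⟨StrongDual ℝ G, inferInstance, inferInstance, inferInstance,
    (ContinuousLinearMap.precomp ℝ G.subtypeL).comp (toOperator h),
    LinearMap.mk₂ ℝ (fun d x => d (S' x)) (fun _ _ _ => rfl) (fun _ _ _ => rfl)
      (fun d x x' => by rw [map_add, map_add]) (fun c d x => by rw [map_smul, map_smul]),
    ?_, fun d x => ?_, fun y x => rfl⟩
  · refine ContinuousLinearMap.opNorm_le_bound _ (norm_nonneg h) fun y => ?_
    refine ContinuousLinearMap.opNorm_le_bound _ (by positivity) fun g => ?_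
    exact (toOperator h y).le_of_opNorm_le
      ((toOperator h).le_of_opNorm_le (norm_toOperator_le h) y) (g : V)
  · refine (d.le_opNorm _).trans ?_
    gcongr
    exact (S.le_of_opNorm_le hS1 x).trans_eq (one_mul _)

variable {X : Type u} {Y : Type v} [NormedAddCommGroup X] [NormedSpace ℝ X]
  [NormedAddCommGroup Y] [NormedSpace ℝ Y]

/-- A bound for the pairings of a tensor with the finite-rank operators `Y → X*` in the unit ball is
a bound for its pairings with the finite-rank operators from `Y` into spaces acting on `X**`. -/
theorem sum_bilin_apply_le_of_finiteRank {n : ℕ} (φ : Fin n → Bidual X) (y : Fin n → Y) {b : ℝ}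
    (hb : ∀ S ∈ finiteRankOperators Y (StrongDual ℝ X), ‖S‖ ≤ 1 → ∑ i, φ i (S (y i)) ≤ b)
    {D : Type w} [NormedAddCommGroup D] [NormedSpace ℝ D] (T : Y →L[ℝ] D)
    (hT : T ∈ finiteRankOperators Y D) (hT1 : ‖T‖ ≤ 1) (q : D →ₗ[ℝ] Bidual X →ₗ[ℝ] ℝ)
    (hq : ∀ d φ, |q d φ| ≤ ‖d‖ * ‖φ‖) : ∑ i, q (T (y i)) (φ i) ≤ b := by
  have key : ∀ ε : ℝ, 0 < ε → ∑ i, q (T (y i)) (φ i) ≤ (1 + ε) * b + n * ε := by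
    intro ε hε
    obtain ⟨S, hS, hSn, hSφ⟩ := exists_finiteRank_approx T hT q hq y φ hε
    have h0 : 0 < 1 + ε := by positivity
    -- Rescaling puts `S` into the unit ball, where `hb` applies; the factor `1 + ε` disappears in
    -- the limit.
    have h1 := hb ((1 + ε)⁻¹ • S) (by
      have : FiniteDimensional ℝ (LinearMap.range S.toLinearMap) := hS
      refine Submodule.finiteDimensional_of_le (S₂ := LinearMap.range S.toLinearMap) ?_
      rintro _ ⟨z, rfl⟩
      exact Submodule.smul_mem _ _ ⟨z, rfl⟩) (by
      rw [norm_smul, norm_inv, Real.norm_of_nonneg h0.le, inv_mul_le_iff₀ h0]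
      exact hSn.trans (by gcongr))
    have h2 : ∑ i, φ i (((1 + ε)⁻¹ • S) (y i)) = (1 + ε)⁻¹ * ∑ i, φ i (S (y i)) := by
      rw [Finset.mul_sum]
      exact Finset.sum_congr rfl fun i _ => map_smul (φ i) _ _
    rw [h2, inv_mul_le_iff₀ h0] at h1
    have h3 : ∑ i, q (T (y i)) (φ i) ≤ ∑ i, (φ i (S (y i)) + ε) :=
      Finset.sum_le_sum fun i _ => by linarith [(abs_lt.1 (hSφ i)).1]
    rw [Finset.sum_add_distrib, Finset.sum_const, Finset.card_univ, Fintype.card_fin,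
      nsmul_eq_mul] at h3
    linarith
  have hlim : Tendsto (fun ε : ℝ => (1 + ε) * b + n * ε) (𝓝[>] 0) (𝓝 b) := by
    have : Continuous fun ε : ℝ => (1 + ε) * b + n * ε := by fun_prop
    simpa using (this.tendsto 0).mono_left nhdsWithin_le_nhds
  exact ge_of_tendsto hlim (eventually_nhdsWithin_of_forall fun ε hε => key ε hε)

theorem abs_toOperator_apply_le {V : Type u} {Y : Type v} [NormedAddCommGroup V]
    [NormedSpace ℝ V] [NormedAddCommGroup Y] [NormedSpace ℝ Y]
    {h : StrongDual ℝ (ProjTensorProduct V Y)} (hh : ‖h‖ ≤ 1) (y : Y) (x : V) :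
    |toOperator h y x| ≤ ‖y‖ * ‖x‖ := by
  have h1 := (toOperator h).le_of_opNorm_le ((norm_toOperator_le h).trans hh) y
  rw [one_mul] at h1
  exact (toOperator h y).le_of_opNorm_le h1 x

/-- After `S α` is inserted in the `X**` variable, only the restrictions of the functionals to its
finite-dimensional range matter. They form a finite-dimensional space, so the operator on `Y` has
finite rank. -/
theorem sum_toOperator_apply_le_of_hasMAP_bidual (hMAP : HasMAP (Bidual X)) {n : ℕ}
    (φ : Fin n → Bidual X) (y : Fin n → Y) {b : ℝ}
    (hb : ∀ S ∈ finiteRankOperators Y (StrongDual ℝ X), ‖S‖ ≤ 1 → ∑ i, φ i (S (y i)) ≤ b)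
    {h : StrongDual ℝ (ProjTensorProduct (Bidual X) Y)} (hh : ‖h‖ ≤ 1) :
    ∑ i, toOperator h (y i) (φ i) ≤ b := by
  obtain ⟨ι, _, _, _, S, hS, hS1, hlim⟩ := hMAP
  have hlim' : Tendsto (fun α => ∑ i, toOperator h (y i) (S α (φ i))) atTop
      (𝓝 (∑ i, toOperator h (y i) (φ i))) :=
    tendsto_finsetSum _ fun i _ => ((toOperator h (y i)).continuous.tendsto _).comp (hlim _)
  refine le_of_tendsto hlim' (Eventually.of_forall fun α => ?_)
  obtain ⟨D, _, _, _, T, q, hT, hq, hTq⟩ :=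
    exists_finiteDimensional_factorization h (S α) (hS α) (hS1 α)
  have h1 := sum_bilin_apply_le_of_finiteRank φ y hb T
    (FiniteDimensional.finiteDimensional_submodule _) (hT.trans hh) q hq
  exact (Finset.sum_congr rfl fun i _ => (hTq _ _).symm).trans_le h1

/-- Here `S α` itself is the finite-rank operator, and its target `Y` acts on `X**` through `h`. -/
theorem sum_toOperator_apply_le_of_hasMAP (hMAP : HasMAP Y) {n : ℕ}
    (φ : Fin n → Bidual X) (y : Fin n → Y) {b : ℝ}
    (hb : ∀ S ∈ finiteRankOperators Y (StrongDual ℝ X), ‖S‖ ≤ 1 → ∑ i, φ i (S (y i)) ≤ b)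
    {h : StrongDual ℝ (ProjTensorProduct (Bidual X) Y)} (hh : ‖h‖ ≤ 1) :
    ∑ i, toOperator h (y i) (φ i) ≤ b := by
  obtain ⟨ι, _, _, _, S, hS, hS1, hlim⟩ := hMAP
  have hlim' : Tendsto (fun α => ∑ i, toOperator h (S α (y i)) (φ i)) atTop
      (𝓝 (∑ i, toOperator h (y i) (φ i))) :=
    tendsto_finsetSum _ fun i _ =>
      ((continuous_toOperator_apply h (φ i)).tendsto _).comp (hlim _)
  refine le_of_tendsto hlim' (Eventually.of_forall fun α => ?_)
  exact sum_bilin_apply_le_of_finiteRank φ y hb (S α) (hS α) (hS1 α) (toBilin h)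
    (abs_toOperator_apply_le hh)

theorem norm_coe_ofList_le_of_finiteRank (hMAP : HasMAP (Bidual X) ∨ HasMAP Y)
    (l : List (Bidual X × Y)) {b : ℝ}
    (hb : ∀ S ∈ finiteRankOperators Y (StrongDual ℝ X), ‖S‖ ≤ 1 →
      tensorPairing S ((ProjTensor.ofList l : ProjTensor (Bidual X) Y) :
        ProjTensorProduct (Bidual X) Y) ≤ b) :
    ‖((ProjTensor.ofList l : ProjTensor (Bidual X) Y) : ProjTensorProduct (Bidual X) Y)‖ ≤ b := by
  have hb' : ∀ S ∈ finiteRankOperators Y (StrongDual ℝ X), ‖S‖ ≤ 1 →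
      ∑ i : Fin l.length, l[i].1 (S l[i].2) ≤ b := fun S hS hS1 => by
    have := hb S hS hS1
    rwa [tensorPairing_ofList, ← Fin.sum_univ_fun_getElem] at this
  obtain ⟨h, hh, hu⟩ := exists_dual_vector'' ℝ
    ((ProjTensor.ofList l : ProjTensor (Bidual X) Y) : ProjTensorProduct (Bidual X) Y)
  have hsum : ‖((ProjTensor.ofList l : ProjTensor (Bidual X) Y) :
      ProjTensorProduct (Bidual X) Y)‖ = ∑ i : Fin l.length, toOperator h l[i].2 l[i].1 := by
    refine hu.symm.trans ((ProjTensor.map_ofList (h.comp (UniformSpace.Completion.toComplL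
      (𝕜 := ℝ) (E := ProjTensor (Bidual X) Y))).toLinearMap l).trans ?_)
    exact (Fin.sum_univ_fun_getElem l fun p => toOperator h p.2 p.1).symm
  rw [hsum]
  exact hMAP.elim
    (fun hX => sum_toOperator_apply_le_of_hasMAP_bidual hX
      (fun i : Fin l.length => l[i].1) (fun i => l[i].2) hb' hh)
    (fun hY => sum_toOperator_apply_le_of_hasMAP hY
      (fun i : Fin l.length => l[i].1) (fun i => l[i].2) hb' hh)

/-- If `X**` or `Y` has the metric approximation property, then the finite-rank operators `Y → X*`
are norming for `X** ⊗̂_π Y`. -/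
theorem isNormingForTensor_finiteRankOperators (hMAP : HasMAP (Bidual X) ∨ HasMAP Y) :
    IsNormingForTensor (finiteRankOperators Y (StrongDual ℝ X)) := by
  refine fun u => ⟨?_, fun b hb => ?_⟩
  · rintro _ ⟨T, -, hT, rfl⟩
    simpa using (tensorPairing T).le_of_opNorm_le ((norm_tensorPairing_le T).trans hT) u
  -- The bound `b` is known only for pairings with `u`. The term `‖t - u‖` pays for replacing `u` by
  -- an algebraic tensor, makes the inequality a closed condition, and vanishes at `u`.
  · have key : ∀ t : ProjTensor (Bidual X) Y,
        ‖(t : ProjTensorProduct (Bidual X) Y)‖ ≤ b + ‖(t : ProjTensorProduct (Bidual X) Y) - u‖ := by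
      intro t
      obtain ⟨l, rfl⟩ := ProjTensor.exists_ofList t
      refine norm_coe_ofList_le_of_finiteRank hMAP l fun S hS hS1 => ?_
      have h1 : |tensorPairing S u| ≤ b := hb ⟨S, hS, hS1, rfl⟩
      have h2 := (tensorPairing S).le_of_opNorm_le ((norm_tensorPairing_le S).trans hS1)
        (((ProjTensor.ofList l : ProjTensor (Bidual X) Y) : ProjTensorProduct (Bidual X) Y) - u)
      rw [map_sub, one_mul, Real.norm_eq_abs] at h2
      linarith [le_abs_self (tensorPairing S u), (abs_le.1 h2).2]
    have h3 : ∀ w : ProjTensorProduct (Bidual X) Y, ‖w‖ ≤ b + ‖w - u‖ := by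
      intro w
      induction w using UniformSpace.Completion.induction_on with
      | hp => exact isClosed_le (by fun_prop) (by fun_prop)
      | ih t => exact key t
    simpa using h3 u

/-! ### The almost isometric ideal property. -/

/-- An operator `T` that nearly norms `u` restricts to a functional on the smaller tensor product,
and `toOperator` recovers `T` from it. Hence the map into the bidual is isometric. -/
theorem exists_lt_abs_dualPairing (hMAP : HasMAP (Bidual X) ∨ HasMAP Y)
    (u : ProjTensorProduct (Bidual X) Y) {r : ℝ} (hr : r < ‖u‖) :
    ∃ h : StrongDual ℝ (ProjTensorProduct X Y), ‖h‖ ≤ 1 ∧ r < |dualPairing X Y u h| := by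
  obtain ⟨_, ⟨T, -, hT, rfl⟩, hrT⟩ :=
    (lt_isLUB_iff (isNormingForTensor_finiteRankOperators hMAP u)).1 hr
  refine ⟨(tensorPairing T).comp (bidualInclusion X Y), ?_, ?_⟩
  · refine ContinuousLinearMap.opNorm_le_bound _ zero_le_one fun z => ?_
    exact ((tensorPairing T).le_of_opNorm_le ((norm_tensorPairing_le T).trans hT) _).trans
      (by gcongr; exact norm_bidualInclusion_le z)
  · have e : toOperator ((tensorPairing T).comp (bidualInclusion X Y)) = T := by
      ext y x
      rw [toOperator_apply, ContinuousLinearMap.comp_apply, bidualInclusion_tmul,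
        tensorPairing_tmul]
      rfl
    rwa [dualPairing_apply, e]

/-- If `X**` or `Y` has the metric approximation property, then `X ⊗̂_π Y` is an almost isometric
ideal in `X** ⊗̂_π Y`. -/
theorem isAlmostIsometricIdeal_range_bidualInclusion (hMAP : HasMAP (Bidual X) ∨ HasMAP Y) :
    IsAlmostIsometricIdeal (LinearMap.range (bidualInclusion X Y).toLinearMap) := by
  intro ε hε E _
  have hiso := isometry_bidualInclusion X Y
  let ι := (bidualInclusion X Y).toLinearMap
  let e := LinearEquiv.ofInjective ι hiso.injective
  let E₀ : Submodule ℝ E := (LinearMap.range ι).comap E.subtype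
  -- On `E₀` the map must invert the inclusion. The extension to `E` is arbitrary, since local
  -- reflexivity uses `R₀` only through its values on `E₀`.
  obtain ⟨R₀, hR₀⟩ := LinearMap.exists_extend (p := E₀)
    (e.symm.toLinearMap.comp (E.subtype.restrict fun x (hx : x ∈ E₀) => hx))
  have hι : ∀ x ∈ E₀, bidualInclusion X Y (R₀ x) = x := fun x hx => by
    have h1 := LinearMap.congr_fun hR₀ ⟨x, hx⟩
    have h2 : R₀ x = e.symm ⟨x, hx⟩ := h1
    rw [h2]
    exact congrArg Subtype.val (e.apply_symm_apply ⟨x, hx⟩)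
  obtain ⟨R, hR, hRn⟩ := exists_linearMap_almost_isometry ((dualPairing X Y).comp E.subtype)
    (fun x h => abs_dualPairing_le (x : ProjTensorProduct (Bidual X) Y) h)
    (fun x r hr => exists_lt_abs_dualPairing hMAP (x : ProjTensorProduct (Bidual X) Y) hr)
    E₀ R₀ (fun x hx h => by
      rw [← dualPairing_bidualInclusion, hι x hx]
      rfl) hε
  have hnorm : ∀ z, ‖bidualInclusion X Y z‖ = ‖z‖ := fun z => hiso.norm_map_of_map_zero (map_zero _) z
  refine ⟨ι.rangeRestrict.comp R, fun x hx => ?_, fun x => ?_⟩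
  · exact (congrArg (bidualInclusion X Y) (hR x hx)).trans (hι x hx)
  · have h1 : ‖ι.rangeRestrict.comp R x‖ = ‖R x‖ := hnorm (R x)
    rw [h1]
    exact hRn x

end Norming

theorem mainTheorem11 (X : Type u) (Y : Type v)
    [NormedAddCommGroup X] [NormedSpace ℝ X] [CompleteSpace X]
    [NormedAddCommGroup Y] [NormedSpace ℝ Y] [CompleteSpace Y]
    (hMAP : HasMAP (Bidual X) ∨ HasMAP Y) :
    IsNormingForTensor (finiteRankOperators Y (StrongDual ℝ X)) ∧
      Isometry (bidualInclusion X Y) ∧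
      IsAlmostIsometricIdeal (LinearMap.range (bidualInclusion X Y).toLinearMap) :=
  ⟨isNormingForTensor_finiteRankOperators hMAP, isometry_bidualInclusion X Y,
    isAlmostIsometricIdeal_range_bidualInclusion hMAP⟩
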